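/- Let $M$ be a commutative monoid with zero $z$ and group of units $G$ such that the ideal $M\setminus G$ of nonunits is principal and generated by a nilpotent element $t$, i.e. $M\setminus G=Mt$. Let $k\ge 0$ be the largest integer with $t^k\neq z$. Then the (nonempty) ideals of $M$ are exactly the principal ideals $Mt^i$ with $0\le i\le k+1$, and they form a chain under inclusion. Assume moreover that $M$ is finite. Let $G_i=\{g\in G : gt^i=t^i\}$ be the stabilizer of $t^i$ in $G$ for $0\le i\le k$, let $\widehat G$ be the group of homomorphisms $\chi\colon G\to\mathbb C^\times$, and for $\chi\in\widehat G$ let $i_\chi$ be the largest index $i\in\{0,\dots,k\}$ with $G_i\subseteq\ker\chi$. Let $\{x_m : m\in M\setminus\{z\}\}$ be variables, and let $\widetilde\theta_M\in\mathbb C[x_m : m\in M\setminus\{z\}]$ be the contracted semigroup determinant of $M$, i.e. the determinant of the matrix with rows and columns indexed by $M\setminus\{z\}$ whose $(s,t')$ entry is $x_{st'}$ if $st'\neq z$ and $0$ otherwise. Then \[ \widetilde\theta_M=\pm\prod_{\chi\in\widehat G}\left[\left(\prod_{0\le i\le i_\chi}\frac1{|G_i|}\right)\left(\sum_{g\in G}\overline{\chi(g)}\,x_{gt^{i_\chi}}\right)^{i_\chi+1}\right].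 \] -/

import Mathlib

open scoped ComplexConjugate

namespace SemigroupDet

/-- The principal ideal `M a = {m * a | m ∈ M}` of a commutative monoid. -/
def principalIdeal {M : Type*} [CommMonoid M] (a : M) : SemigroupIdeal M where
  carrier := Set.range fun m : M => m * a
  smul_mem' := by
    rintro c _ ⟨m, rfl⟩
    exact ⟨c * m, mul_assoc c m a⟩

/-- The polynomial ring `ℂ[x_m : m ∈ M, m ≠ 0]`. -/
abbrev ContractedPoly (M : Type*) [Zero M] : Type _ := MvPolynomial {m : M // m ≠ 0} ℂ

/-- The variable `x_m` if `m ≠ 0`, and `0` if `m` is the zero of `M` (which is identified with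
the zero of the contracted algebra). -/
noncomputable def var {M : Type*} [Zero M] [DecidableEq M] (m : M) : ContractedPoly M :=
  if h : m = 0 then 0 else MvPolynomial.X ⟨m, h⟩

/-- The contracted Cayley table: rows and columns are indexed by the nonzero elements of `M`, and
the `(s, t)` entry is `x_{st}` if `st ≠ 0` and `0` otherwise. -/
noncomputable def contractedTable (M : Type*) [CommMonoidWithZero M] [DecidableEq M] :
    Matrix {m : M // m ≠ 0} {m : M // m ≠ 0} (ContractedPoly M) :=
  Matrix.of fun s t => var ((s : M) * (t : M))

/-- The contracted semigroup determinant of a finite commutative monoid with zero. -/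
noncomputable def contractedDet (M : Type*) [CommMonoidWithZero M] [Fintype M] [DecidableEq M] :
    ContractedPoly M :=
  (contractedTable M).det

/-- The stabilizer `{g ∈ G | g * m = m}` of `m` in the group of units `G` of `M`. -/
def unitStabilizer {M : Type*} [CommMonoid M] (m : M) : Subgroup Mˣ :=
  MulAction.stabilizer Mˣ m

open Classical in
/-- For a character `χ` of the group of units, the largest index `i ≤ k` such that the
stabilizer of `t ^ i` is contained in the kernel of `χ`. -/
noncomputable def charIndex {M : Type*} [CommMonoid M] (t : M) (k : ℕ) (χ : Mˣ →* ℂˣ) : ℕ :=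
  Nat.findGreatest (fun i => unitStabilizer (t ^ i) ≤ χ.ker) k

/-- `charIndex` is what its description says: the set of indices in question is never empty. -/
theorem isGreatest_charIndex {M : Type*} [CommMonoid M] (t : M) (k : ℕ) (χ : Mˣ →* ℂˣ) :
    IsGreatest {i | i ≤ k ∧ unitStabilizer (t ^ i) ≤ χ.ker} (charIndex t k χ) := by
  classical
  refine ⟨⟨Nat.findGreatest_le k, ?_⟩, fun i hi => Nat.le_findGreatest hi.1 hi.2⟩
  refine Nat.findGreatest_spec (P := fun i => unitStabilizer (t ^ i) ≤ χ.ker) (Nat.zero_le k) ?_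
  intro g hg
  have h : g • (t ^ 0) = t ^ 0 := hg
  have h1 : g = 1 := by
    apply Units.ext
    simpa [Units.smul_def] using h
  simp [h1]

/-- The finite type of complex characters of a finite abelian group. -/
noncomputable instance fintypeCharacters (G : Type*) [CommGroup G] [Finite G] :
    Fintype (G →* ℂˣ) :=
  Fintype.ofFinite _

/-- The linear form `∑_{g ∈ G} conj (χ g) * x_{g m}`. -/
noncomputable def charForm {M : Type*} [CommMonoidWithZero M] [Fintype M] [DecidableEq M]
    (χ : Mˣ →* ℂˣ) (m : M) : ContractedPoly M :=
  ∑ g : Mˣ, MvPolynomial.C (conj (χ g : ℂ)) * var ((g : M) * m)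

end SemigroupDet

open SemigroupDet

/-! Every nonzero element is `g * t ^ i` with `g` a unit and a unique `i ≤ k`, so the nonzero
elements split into orbits `G / G_i`. This gives the ideals, each generated by the least power of
`t` it contains. For the determinant, take the vectors `v_{χ,i} = ∑ conj (χ g) [g t ^ i]` with `i ≤
i_χ`; by duality for `G / G_i` there are as many as nonzero elements. Let `A` be their coefficient
matrix and `B` the contracted table. By orthogonality `A Aᵀ` is monomial, so `(det A)² = ± ∏ |G|
|G_i|` (`sum_charCoeff_mul_charCoeff`). The matrix `A B Aᵀ` is block diagonal in `χ`, with entries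
`|G| * charForm χ (t ^ (i + j))` (`sum_charCoeff_mul_var`) that vanish for `i + j > i_χ`
(`charForm_eq_zero`). Its blocks are thus anti-triangular, and comparing determinants cancels the
powers of `|G|` and leaves the factors `1 / |G_i|`. -/

namespace SemigroupDet

/-! ### Normal form of elements and the chain of ideals. -/

section Ideals

variable {M : Type*} [CommMonoidWithZero M] {t : M} {k : ℕ}

theorem pow_ne_zero_of_isGreatest (hk : IsGreatest {i : ℕ | t ^ i ≠ 0} k) {i : ℕ} (hi : i ≤ k) :
    t ^ i ≠ 0 := fun h => hk.1 (pow_eq_zero_of_le hi h)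

theorem pow_eq_zero_of_isGreatest (hk : IsGreatest {i : ℕ | t ^ i ≠ 0} k) {i : ℕ} (hi : k < i) :
    t ^ i = 0 := by
  by_contra h
  exact absurd (hk.2 h) (not_le.2 hi)

/-- Factors `t` are peeled off for as long as the cofactor is a nonunit. -/
theorem exists_unit_mul_pow_or (hgen : nonunits M = (principalIdeal t : Set M)) (m : M) (n : ℕ) :
    (∃ i < n, ∃ g : Mˣ, m = g * t ^ i) ∨ ∃ a, m = a * t ^ n := by
  induction n with
  | zero => exact Or.inr ⟨m, by simp⟩
  | succ n ih =>
    rcases ih with ⟨i, hi, g, h⟩ | ⟨a, h⟩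
    · exact Or.inl ⟨i, by omega, g, h⟩
    · by_cases ha : IsUnit a
      · obtain ⟨g, rfl⟩ := ha
        exact Or.inl ⟨n, by omega, g, h⟩
      · have hmem : a ∈ (principalIdeal t : Set M) := hgen ▸ ha
        obtain ⟨b, rfl⟩ := hmem
        exact Or.inr ⟨b, by rw [h, pow_succ', mul_assoc]⟩

theorem exists_unit_mul_pow (hgen : nonunits M = (principalIdeal t : Set M))
    (hk : IsGreatest {i : ℕ | t ^ i ≠ 0} k) {m : M} (hm : m ≠ 0) :
    ∃ i ≤ k, ∃ g : Mˣ, m = g * t ^ i := by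
  rcases exists_unit_mul_pow_or hgen m (k + 1) with ⟨i, hi, g, h⟩ | ⟨a, h⟩
  · exact ⟨i, by omega, g, h⟩
  · rw [pow_eq_zero_of_isGreatest hk (Nat.lt_succ_self k), mul_zero] at h
    exact absurd h hm

theorem exponent_le_of_unit_mul_pow_eq (hk : IsGreatest {i : ℕ | t ^ i ≠ 0} k) {i j : ℕ}
    (hi : i ≤ k) {g h : Mˣ} (e : (g : M) * t ^ i = h * t ^ j) : j ≤ i := by
  by_contra hij
  -- Multiplying by `t ^ (k - i)` keeps the left side nonzero, but kills the right side if `i < j`.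
  have e' : (g : M) * t ^ k = h * t ^ (j + (k - i)) := by
    rw [pow_add, ← mul_assoc, ← e, mul_assoc, ← pow_add, Nat.add_sub_cancel' hi]
  rw [pow_eq_zero_of_isGreatest hk (by omega : k < j + (k - i)), mul_zero] at e'
  exact hk.1 (by simpa using e')

theorem principalIdeal_pow_anti {i j : ℕ} (h : i ≤ j) :
    principalIdeal (t ^ j) ≤ principalIdeal (t ^ i) := by
  rintro _ ⟨m, rfl⟩
  exact ⟨m * t ^ (j - i), by simp only [mul_assoc, ← pow_add, Nat.sub_add_cancel h]⟩

theorem nonempty_ideals_eq (hgen : nonunits M = (principalIdeal t : Set M))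
    (hk : IsGreatest {i : ℕ | t ^ i ≠ 0} k) :
    {I : SemigroupIdeal M | (I : Set M).Nonempty} =
      (fun i : ℕ => principalIdeal (t ^ i)) '' Set.Iic (k + 1) := by
  classical
  ext I
  constructor
  · rintro ⟨x, hx⟩
    have h0 : (0 : M) ∈ I := by simpa using I.smul_mem (0 : M) hx
    have hex : ∃ i, t ^ i ∈ I :=
      ⟨k + 1, by rwa [pow_eq_zero_of_isGreatest hk (Nat.lt_succ_self k)]⟩
    refine ⟨Nat.find hex, Nat.find_min' hex ?_, ?_⟩
    · rwa [pow_eq_zero_of_isGreatest hk (Nat.lt_succ_self k)]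
    · refine le_antisymm ?_ ?_
      · rintro _ ⟨m, rfl⟩
        exact I.smul_mem m (Nat.find_spec hex)
      · intro m hm
        rcases exists_unit_mul_pow_or hgen m (Nat.find hex) with ⟨i, hi, g, h⟩ | ⟨a, h⟩
        -- Cancelling the unit would put the smaller power `t ^ i` in `I`.
        · refine absurd ?_ (Nat.find_min hex hi)
          have := I.smul_mem (↑g⁻¹ : M) hm
          rwa [h, smul_eq_mul, Units.inv_mul_cancel_left] at this
        · exact ⟨a, h.symm⟩
  · rintro ⟨i, -, rfl⟩
    exact ⟨_, 1, rfl⟩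

theorem isChain_nonempty_ideals (hgen : nonunits M = (principalIdeal t : Set M))
    (hk : IsGreatest {i : ℕ | t ^ i ≠ 0} k) :
    IsChain (· ≤ ·) {I : SemigroupIdeal M | (I : Set M).Nonempty} := by
  rw [nonempty_ideals_eq hgen hk]
  rintro _ ⟨i, -, rfl⟩ _ ⟨j, -, rfl⟩ -
  rcases le_total i j with h | h
  · exact Or.inr (principalIdeal_pow_anti h)
  · exact Or.inl (principalIdeal_pow_anti h)

end Ideals

/-! ### Orthogonality and counting of characters. -/

section Characters

variable {G : Type*} [CommGroup G]

/-- The conjugate of a complex character, as a homomorphism to `ℂ`. -/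
noncomputable def conjChar (χ : G →* ℂˣ) : G →* ℂ :=
  (starRingEnd ℂ : ℂ →* ℂ).comp ((Units.coeHom ℂ).comp χ)

theorem conjChar_apply (χ : G →* ℂˣ) (g : G) : conjChar χ g = conj (χ g : ℂ) := rfl

theorem conjChar_injective : Function.Injective (conjChar : (G →* ℂˣ) → G →* ℂ) := by
  intro χ ψ h
  ext g
  exact (starRingEnd ℂ).injective (DFunLike.congr_fun h g)

theorem conjChar_one : conjChar (1 : G →* ℂˣ) = 1 := by
  ext g
  simp [conjChar_apply]

theorem conjChar_mul (χ ψ : G →* ℂˣ) (g : G) :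
    conjChar (χ * ψ) g = conjChar χ g * conjChar ψ g := by
  simp [conjChar_apply]

theorem conjChar_inv (χ : G →* ℂˣ) (g : G) : conjChar χ⁻¹ g = conjChar χ g⁻¹ := by
  simp [conjChar_apply]

/-- Both factors are conjugated, so the pairing is bilinear and matches `χ` with its inverse rather
than with itself. -/
theorem sum_conjChar_mul [Fintype G] [DecidableEq (G →* ℂˣ)] (χ ψ : G →* ℂˣ) :
    ∑ g, conjChar χ g * conjChar ψ g = if ψ = χ⁻¹ then (Nat.card G : ℂ) else 0 := by
  classical
  have h1 : conjChar (χ * ψ) = 1 ↔ ψ = χ⁻¹ := by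
    rw [← conjChar_one, conjChar_injective.eq_iff]
    exact @mul_eq_one_iff_eq_inv' (G →* ℂˣ) _ χ ψ
  simp_rw [← conjChar_mul]
  rw [sum_hom_units, Nat.card_eq_fintype_card]
  simp only [h1]
  split_ifs <;> simp

theorem card_characters_trivial_on [Finite G] (H : Subgroup G) :
    Nat.card {χ : G →* ℂˣ // H ≤ χ.ker} = Nat.card (G ⧸ H) := by
  rw [← CommGroup.card_monoidHom_of_hasEnoughRootsOfUnity (G ⧸ H) ℂ]
  refine Nat.card_congr
    { toFun := fun χ => QuotientGroup.lift H χ.1 χ.2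
      invFun := fun ψ => ⟨ψ.comp (QuotientGroup.mk' H), fun g hg => by
        simp [MonoidHom.mem_ker, (QuotientGroup.eq_one_iff g).2 hg]⟩
      left_inv := fun χ => by ext; simp
      right_inv := fun ψ => by ext; simp }

end Characters

/-! ### Determinants of block anti-triangular matrices. -/

section Determinants

theorem det_of_blockTriangular_injective {R m β : Type*} [CommRing R] [Fintype m] [DecidableEq m]
    [LinearOrder β] {b : m → β} (hb : Function.Injective b) {A : Matrix m m R}
    (hA : A.BlockTriangular b) : A.det = ∏ i, A i i := by
  let _ : LinearOrder m := LinearOrder.lift' b hb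
  have h : A.IsUpperTriangular := fun i j hij => hA hij
  convert Matrix.det_of_isUpperTriangular h

/-- A block diagonal matrix with anti-triangular blocks that are constant on the antidiagonal. -/
theorem exists_sign_det_of_antitriangular_blocks {R α : Type*} [CommRing R] [Fintype α]
    (n : α → ℕ) [DecidableEq (Σ a, Fin (n a + 1))]
    (D : Matrix (Σ a, Fin (n a + 1)) (Σ a, Fin (n a + 1)) R) (f : α → R)
    (hblock : ∀ x y, x.1 ≠ y.1 → D x y = 0)
    (hzero : ∀ a (i j : Fin (n a + 1)), n a < i.1 + j.1 → D ⟨a, i⟩ ⟨a, j⟩ = 0)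
    (hanti : ∀ a (i j : Fin (n a + 1)), i.1 + j.1 = n a → D ⟨a, i⟩ ⟨a, j⟩ = f a) :
    ∃ ε : ℤˣ, D.det = ((ε : ℤ) : R) * ∏ a, f a ^ (n a + 1) := by
  classical
  -- Reversing the columns within each block makes the matrix upper triangular for the lexicographic
  -- order `enc`, with `f a` on the diagonal.
  let σ : Equiv.Perm (Σ a, Fin (n a + 1)) := Equiv.sigmaCongrRight fun _ => Fin.revPerm
  have key : (D.submatrix id σ).det = ∏ a, f a ^ (n a + 1) := by
    let enc : (Σ a, Fin (n a + 1)) → Fin (Fintype.card α) ×ₗ ℕ :=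
      fun x => toLex (Fintype.equivFin α x.1, x.2.1)
    have henc : Function.Injective enc := by
      rintro ⟨a, i⟩ ⟨b, j⟩ h
      have h' := toLex.injective h
      simp only [Prod.mk.injEq, EmbeddingLike.apply_eq_iff_eq] at h'
      obtain ⟨rfl, h2⟩ := h'
      rw [Fin.ext h2]
    have htri : (D.submatrix id σ).BlockTriangular enc := by
      rintro ⟨a, i⟩ ⟨b, j⟩ h
      have h' : enc ⟨b, j⟩ < enc ⟨a, i⟩ := h
      simp only [enc, Prod.Lex.toLex_lt_toLex] at h'
      rcases h' with h' | ⟨h1, h2⟩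
      · refine hblock _ _ ?_
        rintro (rfl : a = b)
        exact lt_irrefl _ h'
      · obtain rfl : b = a := (Fintype.equivFin α).injective h1
        refine hzero b i (Fin.rev j) ?_
        have := j.2
        simp only [Fin.val_rev] at *
        omega
    have := det_of_blockTriangular_injective henc htri
    rw [Fintype.prod_sigma] at this
    convert this using 2 with a
    rw [Finset.prod_congr rfl (g := fun _ => f a)]
    · simp
    · intro i _
      refine hanti a i (Fin.rev i) ?_
      have := i.2
      simp only [Fin.val_rev]
      omega
  refine ⟨Equiv.Perm.sign σ, ?_⟩
  rw [← key, Matrix.det_permute', ← mul_assoc, ← Int.cast_mul, ← Units.val_mul,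
    Int.units_mul_self]
  simp

end Determinants

/-! ### Admissible pairs `(χ, i)` and their number. -/

section Contracted

variable {M : Type*} [CommMonoidWithZero M] {t : M} {k : ℕ}

theorem unitStabilizer_mono {i j : ℕ} (h : i ≤ j) :
    unitStabilizer (t ^ i) ≤ unitStabilizer (t ^ j) := by
  intro g hg
  have hg' : (g : M) * t ^ i = t ^ i := hg
  change (g : M) * t ^ j = t ^ j
  rw [← Nat.add_sub_cancel' h, pow_add, ← mul_assoc, hg']

theorem le_charIndex_iff {χ : Mˣ →* ℂˣ} {i : ℕ} :
    i ≤ charIndex t k χ ↔ i ≤ k ∧ unitStabilizer (t ^ i) ≤ χ.ker := by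
  have h := isGreatest_charIndex t k χ
  exact ⟨fun hi => ⟨hi.trans h.1.1, (unitStabilizer_mono hi).trans h.1.2⟩, fun hi => h.2 hi⟩

theorem charIndex_inv (χ : Mˣ →* ℂˣ) : charIndex t k χ⁻¹ = charIndex t k χ := by
  have : (χ⁻¹).ker = χ.ker := by
    ext g
    simp [MonoidHom.mem_ker]
  unfold charIndex
  rw [this]

/-- Pairs of a character `χ` and an exponent `i ≤ charIndex t k χ`. -/
abbrev CharPair (t : M) (k : ℕ) : Type _ := Σ χ : Mˣ →* ℂˣ, Fin (charIndex t k χ + 1)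

theorem CharPair.le (a : CharPair t k) : a.2.1 ≤ k :=
  (le_charIndex_iff.1 (Nat.lt_succ_iff.1 a.2.2)).1

theorem CharPair.stabilizer_le (a : CharPair t k) : unitStabilizer (t ^ a.2.1) ≤ a.1.ker :=
  (le_charIndex_iff.1 (Nat.lt_succ_iff.1 a.2.2)).2

theorem CharPair.ext_val {a b : CharPair t k} (h1 : a.1 = b.1) (h2 : a.2.1 = b.2.1) : a = b := by
  obtain ⟨χ, i⟩ := a
  obtain ⟨ψ, j⟩ := b
  obtain rfl : χ = ψ := h1
  exact congrArg (Sigma.mk χ) (Fin.ext h2)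

/-- The involution `(χ, i) ↦ (χ⁻¹, i)`. -/
def CharPair.inv : Equiv.Perm (CharPair t k) where
  toFun a := ⟨a.1⁻¹, a.2.1, by rw [charIndex_inv]; exact a.2.2⟩
  invFun a := ⟨a.1⁻¹, a.2.1, by rw [charIndex_inv]; exact a.2.2⟩
  left_inv a := CharPair.ext_val (inv_inv a.1) rfl
  right_inv a := CharPair.ext_val (inv_inv a.1) rfl

theorem CharPair.inv_fst (a : CharPair t k) : (CharPair.inv a).1 = a.1⁻¹ := rfl

theorem CharPair.inv_snd_val (a : CharPair t k) : (CharPair.inv a).2.1 = a.2.1 := rfl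

/-- The nonzero elements are the disjoint union of the orbits of the powers `t ^ i`, `i ≤ k`. -/
theorem card_ne_zero_eq_sum [Finite M] (hgen : nonunits M = (principalIdeal t : Set M))
    (hk : IsGreatest {i : ℕ | t ^ i ≠ 0} k) :
    Nat.card {m : M // m ≠ 0} = ∑ i : Fin (k + 1), Nat.card (Mˣ ⧸ unitStabilizer (t ^ i.1)) := by
  have e : (Σ i : Fin (k + 1), MulAction.orbit Mˣ (t ^ i.1)) ≃ {m : M // m ≠ 0} := by
    refine Equiv.ofBijective (fun x => ⟨x.2.1, ?_⟩) ⟨?_, ?_⟩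
    · obtain ⟨i, _, g, rfl⟩ := x
      have := pow_ne_zero_of_isGreatest hk (Nat.lt_succ_iff.1 i.2)
      simpa [Units.smul_def] using this
    · rintro ⟨i, _, g, rfl⟩ ⟨j, _, h, rfl⟩ e
      have e' : (g : M) * t ^ i.1 = h * t ^ j.1 := congrArg Subtype.val e
      obtain rfl : i = j := Fin.ext <| le_antisymm
        (exponent_le_of_unit_mul_pow_eq hk (Nat.lt_succ_iff.1 j.2) e'.symm)
        (exponent_le_of_unit_mul_pow_eq hk (Nat.lt_succ_iff.1 i.2) e')
      have : (⟨g • t ^ i.1, g, rfl⟩ : MulAction.orbit Mˣ (t ^ i.1)) = ⟨h • t ^ i.1, h, rfl⟩ :=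
        Subtype.ext e'
      exact congrArg (Sigma.mk i) this
    · rintro ⟨m, hm⟩
      obtain ⟨i, hi, g, rfl⟩ := exists_unit_mul_pow hgen hk hm
      exact ⟨⟨⟨i, Nat.lt_succ_iff.2 hi⟩, g • t ^ i, g, rfl⟩, rfl⟩
  rw [← Nat.card_congr e, Nat.card_sigma]
  exact Finset.sum_congr rfl fun i _ =>
    Nat.card_congr (MulAction.orbitEquivQuotientStabilizer Mˣ (t ^ i.1))

theorem card_charPair [Finite M] :
    Nat.card (CharPair t k) = ∑ i : Fin (k + 1), Nat.card (Mˣ ⧸ unitStabilizer (t ^ i.1)) := by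
  -- Since the stabilizers increase with `i`, the condition `i ≤ i_χ` says that `χ` is trivial on
  -- `G_i`; the pairs can then be counted by `i`.
  have e : CharPair t k ≃
      Σ i : Fin (k + 1), {χ : Mˣ →* ℂˣ // unitStabilizer (t ^ i.1) ≤ χ.ker} :=
    { toFun := fun a => ⟨⟨a.2.1, Nat.lt_succ_iff.2 a.le⟩, a.1, a.stabilizer_le⟩
      invFun := fun b => ⟨b.2.1, b.1.1,
        Nat.lt_succ_iff.2 (le_charIndex_iff.2 ⟨Nat.lt_succ_iff.1 b.1.2, b.2.2⟩)⟩
      left_inv := fun _ => rfl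
      right_inv := fun _ => rfl }
  rw [Nat.card_congr e, Nat.card_sigma]
  exact Finset.sum_congr rfl fun i _ => card_characters_trivial_on _

theorem nonempty_charPair_equiv [Finite M] (hgen : nonunits M = (principalIdeal t : Set M))
    (hk : IsGreatest {i : ℕ | t ^ i ≠ 0} k) :
    Nonempty (CharPair t k ≃ {m : M // m ≠ 0}) :=
  Finite.card_eq.1 (card_charPair.trans (card_ne_zero_eq_sum hgen hk).symm)

/-! ### The change of basis and the determinant. -/

variable [Fintype M] [DecidableEq M]

/-- The coefficient of `m` in the vector `∑ g, conj (χ g) • [g * t ^ i]`. -/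
noncomputable def charCoeff (a : CharPair t k) (m : M) : ℂ :=
  ∑ g : Mˣ, if (g : M) * t ^ a.2.1 = m then conjChar a.1 g else 0

theorem sum_charCoeff {R : Type*} [CommRing R] [Algebra ℂ R]
    (hk : IsGreatest {i : ℕ | t ^ i ≠ 0} k) (a : CharPair t k) (f : M → R) :
    ∑ m : {m : M // m ≠ 0}, algebraMap ℂ R (charCoeff a (m : M)) * f m =
      ∑ g : Mˣ, algebraMap ℂ R (conjChar a.1 g) * f (g * t ^ a.2.1) := by
  simp_rw [charCoeff, map_sum, Finset.sum_mul]
  rw [Finset.sum_comm]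
  refine Finset.sum_congr rfl fun g _ => ?_
  have hne : (g : M) * t ^ a.2.1 ≠ 0 := by
    simpa using pow_ne_zero_of_isGreatest hk a.le
  rw [Finset.sum_eq_single ⟨(g : M) * t ^ a.2.1, hne⟩]
  · simp
  · intro m _ hm
    rw [if_neg fun h => hm (Subtype.ext h.symm)]
    simp
  · simp

/-- Different exponents give disjoint supports. For equal exponents, the coefficient of `b` at `g *
t ^ i` is `|G_i|` times its conjugate character at `g`, and orthogonality applies. -/
theorem sum_charCoeff_mul_charCoeff [DecidableEq (CharPair t k)]
    (hk : IsGreatest {i : ℕ | t ^ i ≠ 0} k) (a b : CharPair t k) :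
    ∑ m : {m : M // m ≠ 0}, charCoeff a (m : M) * charCoeff b (m : M) =
      if b = CharPair.inv a then
        (Nat.card Mˣ : ℂ) * Nat.card (unitStabilizer (t ^ a.2.1)) else 0 := by
  classical
  have h := sum_charCoeff (R := ℂ) hk a (fun m => charCoeff b m)
  simp only [Algebra.algebraMap_self, RingHom.id_apply] at h
  rw [h]
  by_cases hij : a.2.1 = b.2.1
  · have hb : ∀ g : Mˣ, charCoeff b ((g : M) * t ^ a.2.1) =
        Nat.card (unitStabilizer (t ^ a.2.1)) * conjChar b.1 g := by
      intro g
      rw [charCoeff, ← Equiv.sum_comp (Equiv.mulLeft g), ← Finset.sum_filter,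
        Finset.sum_congr rfl (g := fun _ => conjChar b.1 g)]
      · rw [Finset.sum_const, nsmul_eq_mul, Nat.card_eq_fintype_card, Fintype.card_subtype]
        congr 3
        ext s
        simp only [Equiv.coe_mulLeft, Units.val_mul, mul_assoc, Units.mul_right_inj, ← hij,
          Finset.mem_filter, Finset.mem_univ, true_and]
        rfl
      · intro s hs
        simp only [Equiv.coe_mulLeft, Units.val_mul, mul_assoc, Units.mul_right_inj, ← hij,
          Finset.mem_filter, Finset.mem_univ, true_and] at hs
        have hs' : s ∈ unitStabilizer (t ^ b.2.1) := by rw [← hij]; exact hs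
        have := b.stabilizer_le hs'
        rw [MonoidHom.mem_ker] at this
        rw [Equiv.coe_mulLeft, map_mul, conjChar_apply _ s, this]
        simp
    simp_rw [hb, mul_left_comm _ (Nat.card (unitStabilizer (t ^ a.2.1)) : ℂ)]
    rw [← Finset.mul_sum, sum_conjChar_mul]
    have hiff : b = CharPair.inv a ↔ b.1 = a.1⁻¹ :=
      ⟨fun h => h ▸ CharPair.inv_fst a, fun h => CharPair.ext_val (h.trans a.inv_fst.symm)
        (hij.symm.trans a.inv_snd_val.symm)⟩
    rw [if_congr hiff rfl rfl, mul_ite, mul_zero, mul_comm]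
  · rw [if_neg]
    · refine Finset.sum_eq_zero fun g _ => ?_
      rw [charCoeff, Finset.sum_eq_zero, mul_zero]
      intro s _
      rw [if_neg]
      intro e
      exact hij (le_antisymm (exponent_le_of_unit_mul_pow_eq hk b.le e)
        (exponent_le_of_unit_mul_pow_eq hk a.le e.symm))
    · rintro rfl
      exact hij a.inv_snd_val.symm

/-- For `n ≤ k`, translation by some `s` in `G_n` outside `ker χ` multiplies the form by `conj (χ s)
≠ 1`. For `n > k` every variable in it is zero. -/
theorem charForm_eq_zero (hk : IsGreatest {i : ℕ | t ^ i ≠ 0} k) (χ : Mˣ →* ℂˣ) {n : ℕ}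
    (hn : charIndex t k χ < n) : charForm χ (t ^ n) = 0 := by
  by_cases hnk : n ≤ k
  · have hnot : ¬ unitStabilizer (t ^ n) ≤ χ.ker := fun h =>
      absurd (le_charIndex_iff.2 ⟨hnk, h⟩) (not_le.2 hn)
    obtain ⟨s, hs, hsχ⟩ := SetLike.not_le_iff_exists.1 hnot
    have hs' : (s : M) * t ^ n = t ^ n := hs
    have h : charForm χ (t ^ n) = MvPolynomial.C (conj (χ s : ℂ)) * charForm χ (t ^ n) := by
      conv_lhs => rw [charForm, ← Equiv.sum_comp (Equiv.mulRight s)]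
      rw [charForm, Finset.mul_sum]
      refine Finset.sum_congr rfl fun g _ => ?_
      simp only [Equiv.coe_mulRight, Units.val_mul, map_mul, mul_assoc, hs']
      ring
    have h' : MvPolynomial.C (1 - conj (χ s : ℂ)) * charForm χ (t ^ n) = 0 := by
      rw [map_sub, map_one, sub_mul, one_mul, ← h, sub_self]
    refine (mul_eq_zero.1 h').resolve_left fun h0 => hsχ ?_
    rw [MvPolynomial.C_eq_zero, sub_eq_zero] at h0
    have h1 := congrArg conj h0
    rw [map_one, Complex.conj_conj] at h1
    exact Units.ext h1.symm
  · simp [charForm, pow_eq_zero_of_isGreatest hk (not_le.1 hnk), var]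

theorem sum_charCoeff_mul_var (hk : IsGreatest {i : ℕ | t ^ i ≠ 0} k)
    [DecidableEq (Mˣ →* ℂˣ)] (a b : CharPair t k) :
    ∑ m : {m : M // m ≠ 0}, MvPolynomial.C (charCoeff a (m : M)) *
      ∑ m' : {m : M // m ≠ 0}, MvPolynomial.C (charCoeff b (m' : M)) * var ((m : M) * m') =
      if a.1 = b.1 then
        MvPolynomial.C (Nat.card Mˣ : ℂ) * charForm a.1 (t ^ (a.2.1 + b.2.1)) else 0 := by
  have hb : ∀ m : M, ∑ m' : {m : M // m ≠ 0},
      MvPolynomial.C (charCoeff b (m' : M)) * (var (m * m') : ContractedPoly M) =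
      ∑ h : Mˣ, MvPolynomial.C (conjChar b.1 h) * var (m * (h * t ^ b.2.1)) := fun m =>
    sum_charCoeff (R := ContractedPoly M) hk b fun m' => var (m * m')
  simp_rw [hb]
  have ha := sum_charCoeff (R := ContractedPoly M) hk a fun m =>
    ∑ h : Mˣ, MvPolynomial.C (conjChar b.1 h) * var (m * (h * t ^ b.2.1))
  simp only [MvPolynomial.algebraMap_eq] at ha
  rw [ha]
  have hsub : ∀ g : Mˣ, ∑ h : Mˣ, MvPolynomial.C (conjChar b.1 h) *
      (var (g * t ^ a.2.1 * (h * t ^ b.2.1)) : ContractedPoly M) =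
      MvPolynomial.C (conjChar b.1⁻¹ g) * charForm b.1 (t ^ (a.2.1 + b.2.1)) := by
    intro g
    -- The substitution `h = g⁻¹ * u` separates the sum over `g` from the form in `u`.
    rw [← Equiv.sum_comp (Equiv.mulLeft g⁻¹), charForm, Finset.mul_sum]
    refine Finset.sum_congr rfl fun u _ => ?_
    rw [Equiv.coe_mulLeft, map_mul, ← conjChar_inv, map_mul, mul_assoc, conjChar_apply b.1]
    congr 3
    rw [mul_mul_mul_comm, ← pow_add, ← Units.val_mul, mul_inv_cancel_left]
  simp_rw [hsub, ← mul_assoc, ← map_mul]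
  rw [← Finset.sum_mul, ← map_sum, sum_conjChar_mul]
  by_cases h : a.1 = b.1
  · have hF : charForm b.1 = charForm a.1 := by rw [h]
    rw [if_pos h, if_pos (by rw [h]), hF]
  · rw [if_neg h, if_neg (fun h' => h (inv_injective h'.symm)), map_zero, zero_mul]

theorem exists_sign_contractedDet (hgen : nonunits M = (principalIdeal t : Set M))
    (hk : IsGreatest {i : ℕ | t ^ i ≠ 0} k) :
    ∃ ε : ℂ, (ε = 1 ∨ ε = -1) ∧
      contractedDet M = MvPolynomial.C ε *
        ∏ χ : Mˣ →* ℂˣ,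
          (MvPolynomial.C (∏ i ∈ Finset.range (charIndex t k χ + 1),
              (1 / (Nat.card (unitStabilizer (t ^ i)) : ℂ))) *
            charForm χ (t ^ charIndex t k χ) ^ (charIndex t k χ + 1)) := by
  classical
  obtain ⟨e⟩ := nonempty_charPair_equiv hgen hk
  let A : Matrix (CharPair t k) (CharPair t k) ℂ := Matrix.of fun a b => charCoeff a (e b : M)
  let B : Matrix (CharPair t k) (CharPair t k) (ContractedPoly M) :=
    (contractedTable M).submatrix e e
  let P : Matrix (CharPair t k) (CharPair t k) (ContractedPoly M) := A.map MvPolynomial.C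
  have hB : B.det = contractedDet M := Matrix.det_submatrix_equiv_self e _
  have hP : P.det = MvPolynomial.C A.det := (RingHom.map_det MvPolynomial.C A).symm
  have hAA : ∀ a b, (A * A.transpose) a b = if b = CharPair.inv a then
      (Nat.card Mˣ : ℂ) * Nat.card (unitStabilizer (t ^ a.2.1)) else 0 := by
    intro a b
    rw [← sum_charCoeff_mul_charCoeff hk, ← Equiv.sum_comp e]
    rfl
  have hdetA : ((Equiv.Perm.sign (CharPair.inv (t := t) (k := k)) : ℤ) : ℂ) * A.det ^ 2 =
      ∏ a : CharPair t k, ((Nat.card Mˣ : ℂ) * Nat.card (unitStabilizer (t ^ a.2.1))) := by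
    -- Permuting the columns of `A * Aᵀ` by `CharPair.inv` makes it diagonal.
    rw [← Matrix.det_diagonal, sq]
    nth_rewrite 2 [← Matrix.det_transpose A]
    rw [← Matrix.det_mul, ← Matrix.det_permute']
    congr 1
    ext a b
    rw [Matrix.submatrix_apply, hAA, Matrix.diagonal_apply]
    simp [eq_comm]
  have hPBP : ∀ a b, (P * (B * P.transpose)) a b = if a.1 = b.1 then
      MvPolynomial.C (Nat.card Mˣ : ℂ) * charForm a.1 (t ^ (a.2.1 + b.2.1)) else 0 := by
    intro a b
    rw [← sum_charCoeff_mul_var hk, ← Equiv.sum_comp e]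
    refine Finset.sum_congr rfl fun x _ => ?_
    rw [← Equiv.sum_comp e]
    refine congrArg₂ _ rfl (Finset.sum_congr rfl fun y _ => mul_comm _ _)
  obtain ⟨δ, hδ⟩ := exists_sign_det_of_antitriangular_blocks (charIndex t k)
    (P * (B * P.transpose))
    (fun χ => MvPolynomial.C (Nat.card Mˣ : ℂ) * charForm χ (t ^ charIndex t k χ))
    (fun a b h => by rw [hPBP, if_neg h])
    (fun χ i j h => by rw [hPBP, if_pos rfl, charForm_eq_zero hk χ h, mul_zero])
    (fun χ i j h => by rw [hPBP, if_pos rfl]; simp only [h])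
  rw [Matrix.det_mul, Matrix.det_mul, Matrix.det_transpose, hB, hP] at hδ
  set s : ℤˣ := Equiv.Perm.sign (CharPair.inv (t := t) (k := k))
  have hcard : ∀ H : Subgroup Mˣ, (Nat.card H : ℂ) ≠ 0 := fun H =>
    Nat.cast_ne_zero.2 Nat.card_pos.ne'
  have hG : (Nat.card Mˣ : ℂ) ≠ 0 := Nat.cast_ne_zero.2 Nat.card_pos.ne'
  have hprod : ∏ a : CharPair t k, ((Nat.card Mˣ : ℂ) * Nat.card (unitStabilizer (t ^ a.2.1))) =
      ∏ χ : Mˣ →* ℂˣ, ((Nat.card Mˣ : ℂ) ^ (charIndex t k χ + 1) *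
        ∏ i ∈ Finset.range (charIndex t k χ + 1), (Nat.card (unitStabilizer (t ^ i)) : ℂ)) := by
    rw [Fintype.prod_sigma]
    refine Finset.prod_congr rfl fun χ _ => ?_
    rw [Finset.prod_mul_distrib, Finset.prod_range]
    simp
  have hne : ∏ a : CharPair t k,
      ((Nat.card Mˣ : ℂ) * Nat.card (unitStabilizer (t ^ a.2.1))) ≠ 0 :=
    Finset.prod_ne_zero_iff.2 fun a _ => mul_ne_zero hG (hcard _)
  -- The sign combines `s`, from the involution on pairs, with `δ`, from the anti-triangular blocks.
  refine ⟨((s * δ : ℤˣ) : ℤ), ?_, ?_⟩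
  · rcases Int.units_eq_one_or (s * δ) with h | h <;> simp [h]
  · refine mul_left_cancel₀ (MvPolynomial.C_ne_zero.2 hne) ?_
    have h1 : MvPolynomial.C (∏ a : CharPair t k,
        ((Nat.card Mˣ : ℂ) * Nat.card (unitStabilizer (t ^ a.2.1)))) * contractedDet M =
        MvPolynomial.C ((s : ℤ) : ℂ) * (MvPolynomial.C A.det *
          (contractedDet M * MvPolynomial.C A.det)) := by
      rw [← hdetA, map_mul, map_pow]
      ring
    have h2 : (∏ χ : Mˣ →* ℂˣ, (MvPolynomial.C (Nat.card Mˣ : ℂ) *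
        charForm χ (t ^ charIndex t k χ)) ^ (charIndex t k χ + 1)) =
        MvPolynomial.C (∏ a : CharPair t k,
          ((Nat.card Mˣ : ℂ) * Nat.card (unitStabilizer (t ^ a.2.1)))) *
        ∏ χ : Mˣ →* ℂˣ,
          (MvPolynomial.C (∏ i ∈ Finset.range (charIndex t k χ + 1),
              (1 / (Nat.card (unitStabilizer (t ^ i)) : ℂ))) *
            charForm χ (t ^ charIndex t k χ) ^ (charIndex t k χ + 1)) := by
      rw [hprod, map_prod, ← Finset.prod_mul_distrib]
      refine Finset.prod_congr rfl fun χ _ => ?_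
      rw [← mul_assoc, ← map_mul, mul_assoc, ← Finset.prod_mul_distrib,
        Finset.prod_eq_one fun i _ => mul_one_div_cancel (hcard _), mul_one, map_pow, mul_pow]
    rw [h1, hδ, h2, Units.val_mul, Int.cast_mul, map_mul]
    simp only [map_intCast]
    ring

end Contracted

end SemigroupDet

open SemigroupDet
theorem corollaryc {M : Type*} [CommMonoidWithZero M] (t : M) (ht : IsNilpotent t)
    (hgen : nonunits M = (principalIdeal t : Set M))
    (k : ℕ) (hk : IsGreatest {i : ℕ | t ^ i ≠ 0} k) :
    ({I : SemigroupIdeal M | (I : Set M).Nonempty} =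
        (fun i : ℕ => principalIdeal (t ^ i)) '' Set.Iic (k + 1)) ∧
      IsChain (· ≤ ·) {I : SemigroupIdeal M | (I : Set M).Nonempty} ∧
      ∀ [Fintype M] [DecidableEq M], ∃ ε : ℂ, (ε = 1 ∨ ε = -1) ∧
        contractedDet M = MvPolynomial.C ε *
          ∏ χ : Mˣ →* ℂˣ,
            (MvPolynomial.C (∏ i ∈ Finset.range (charIndex t k χ + 1),
                (1 / (Nat.card (unitStabilizer (t ^ i)) : ℂ))) *
              charForm χ (t ^ charIndex t k χ) ^ (charIndex t k χ + 1)) :=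
  ⟨nonempty_ideals_eq hgen hk, isChain_nonempty_ideals hgen hk,
    exists_sign_contractedDet hgen hk⟩
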